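/- Let $k$ be a field, let $n\ge 2$ and $d\ge 1$ be integers, and let $H=\{v_1,\ldots,v_q\}\subset\mathbb{N}^n$ be a finite set of vectors all of whose coordinate sums are equal to $d$ (so that the associated monomials ${\bf x}^{v_j}=x_1^{v_{1j}}\cdots x_n^{v_{nj}}\in k[x_1,\ldots,x_n]$, where $v_j=(v_{1j},\ldots,v_{nj})$, all have degree $d$). Call a finite set $S\subset\mathbb{R}^m$ a Hilbert base if $\mathbb{Z}^m\cap\mathbb{R}_+S=\mathbb{N}S$, where $\mathbb{R}_+S$ and $\mathbb{N}S$ are the sets of linear combinations of elements of $S$ with coefficients in $\mathbb{R}_{\ge 0}$ and in $\mathbb{N}=\{0,1,2,\ldots\}$, respectively. Suppose that the lattice $\mathbb{Z}H\subset\mathbb{Z}^n$ generated by $H$ has rank $n$ and that $\{(v_1,1),\ldots,(v_q,1)\}\subset\mathbb{Z}^{n+1}$ is a Hilbert base. Then there exist $n$ distinct vectors $w_1,\ldots,w_n\in H$ such that the associated monomials define a Cremona transformation of $\mathbb{P}^{n-1}_k$, i.e. such that the rational map $$({\bf x}^{w_1}:\cdots:{\bf x}^{w_n}):\ \mathbb{P}^{n-1}_k\dashrightarrow\mathbb{P}^{n-1}_k$$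 is birational (it has a two-sided inverse rational map, given by forms of a common degree over $k$). -/

import Mathlib

namespace MonomialCremona

open MvPolynomial

/-- A set `H ⊆ ℕⁿ` is `d`-stochastic if `d ≥ 1` and every vector of `H` has coordinate sum `d`,
i.e. the associated monomials all have degree `d`. -/
def IsStochastic {n : ℕ} (d : ℕ) (H : Set (Fin n → ℕ)) : Prop :=
  1 ≤ d ∧ ∀ v ∈ H, ∑ i, v i = d

/-- The lattice `ℤ H ⊆ ℤⁿ` generated by a set `H ⊆ ℕⁿ`. -/
def lattice {n : ℕ} (H : Set (Fin n → ℕ)) : Submodule ℤ (Fin n → ℤ) :=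
  Submodule.span ℤ ((fun (v : Fin n → ℕ) (i : Fin n) => (v i : ℤ)) '' H)

/-- The set `(H,1) = {(v,1) : v ∈ H}`, as a subset of `ℝⁿ⁺¹`. -/
def adjoinOne {n : ℕ} (H : Set (Fin n → ℕ)) : Set (Fin (n + 1) → ℝ) :=
  (fun v : Fin n → ℕ => (Fin.snoc (fun i => (v i : ℝ)) 1 : Fin (n + 1) → ℝ)) '' H

/-- The subset `ℤᵐ` of `ℝᵐ`. -/
def integerPoints (m : ℕ) : Set (Fin m → ℝ) :=
  Set.range fun (z : Fin m → ℤ) (i : Fin m) => (z i : ℝ)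

/-- A finite set `S ⊆ ℝᵐ` is a Hilbert base if `ℤᵐ ∩ ℝ₊S = ℕS`. Here `ℝ₊S` is the set of
combinations of elements of `S` with nonnegative real coefficients, and `ℕS` the set of
combinations with coefficients in `ℕ` (the additive submonoid generated by `S`). -/
def IsHilbertBase {m : ℕ} (S : Set (Fin m → ℝ)) : Prop :=
  S.Finite ∧
    integerPoints m ∩ (PointedCone.hull ℝ S : Set (Fin m → ℝ)) =
      (AddSubmonoid.closure S : Set (Fin m → ℝ))

/-- The monomial `x^v = ∏ xᵢ^(vᵢ)`. -/
noncomputable def logMonomial (k : Type*) [Field k] {n : ℕ} (v : Fin n → ℕ) :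
    MvPolynomial (Fin n) k :=
  ∏ i, X i ^ v i

/-- The tuple `f = (f₁, …, fₙ)` represents a rational map `(f₁ : ⋯ : fₙ)` from `ℙⁿ⁻¹` to `ℙⁿ⁻¹`
over `k`: its entries are forms of one common degree, and not all of them are zero. -/
def IsRationalMap {k : Type*} [Field k] {n : ℕ} (f : Fin n → MvPolynomial (Fin n) k) : Prop :=
  (∃ e : ℕ, ∀ i, (f i).IsHomogeneous e) ∧ f ≠ 0

/-- Two (nonzero) tuples of forms define the same rational map: they are proportional over
the field of rational functions. -/
def SameRationalMap {k : Type*} [Field k] {n : ℕ}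
    (f g : Fin n → MvPolynomial (Fin n) k) : Prop :=
  ∀ i j, f i * g j = f j * g i

/-- The composite "first `f`, then `g`": the tuple `(g₁(f₁, …, fₙ), …, gₙ(f₁, …, fₙ))`. -/
noncomputable def compForms {k : Type*} [Field k] {n : ℕ}
    (g f : Fin n → MvPolynomial (Fin n) k) : Fin n → MvPolynomial (Fin n) k :=
  fun i => bind₁ f (g i)

/-- The composite "first `f`, then `g`" is a well-defined rational map and is the identity
`(x₁ : ⋯ : xₙ)` of `ℙⁿ⁻¹`. -/
def CompIsIdentity {k : Type*} [Field k] {n : ℕ}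
    (g f : Fin n → MvPolynomial (Fin n) k) : Prop :=
  compForms g f ≠ 0 ∧ SameRationalMap (compForms g f) X

/-- The tuple `f` defines a Cremona transformation of `ℙⁿ⁻¹` over `k`, i.e. a birational map of
`ℙⁿ⁻¹` to itself: the rational map `(f₁ : ⋯ : fₙ)` has a two-sided inverse rational map. -/
def DefinesCremona {k : Type*} [Field k] {n : ℕ}
    (f : Fin n → MvPolynomial (Fin n) k) : Prop :=
  IsRationalMap f ∧
    ∃ g : Fin n → MvPolynomial (Fin n) k,
      IsRationalMap g ∧ CompIsIdentity g f ∧ CompIsIdentity f g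

end MonomialCremona

/-! The Hilbert base condition makes the monoid `ℕ(H,1)` saturated, and the generators of such a
monoid, when a functional is positive on all of them, contain a basis of the lattice they span
(`IsSaturated.exists_basis`). This goes by induction on facets: a basis from a facet is completed by
one generator at least height above it, because saturation forces every positive height on the
lattice to be at least that of some generator (`IsSaturated.exists_pos_le`).

Since `d ≠ 0`, the lattice `ℤ(H,1)` has rank `n`, so the basis is `(w₁,1), …, (wₙ,1)`. Saturation
also puts every `(x,0)` with `∑ xᵢ = 0` in this lattice. Hence `eᵢ - e₀ = ∑ cᵢₗ wₗ` with `∑ₗ cᵢₗ =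
0`: each ratio `xᵢ/x₀` is a Laurent monomial of degree 0 in the forms `x^{wₗ}`. Clearing
denominators gives the inverse map; linear independence makes it two-sided
(`definesCremona_logMonomial`). -/

/-! ### Saturated monoids, facets and lattice bases. -/

section HilbertBasis

variable {M : Type*} [AddCommGroup M]

/-- The monoid `ℕS` is saturated: it contains every element having a positive multiple in it. -/
def IsSaturated (S : Set M) : Prop :=
  ∀ (k : ℕ) (x : M), 0 < k → k • x ∈ AddSubmonoid.closure S → x ∈ AddSubmonoid.closure S

theorem exists_add_nsmul_sum_mem_closure (S : Finset M) {x : M}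
    (hx : x ∈ Submodule.span ℤ (S : Set M)) :
    ∃ N : ℕ, x + N • ∑ s ∈ S, s ∈ AddSubmonoid.closure (S : Set M) := by
  classical
  set C := AddSubmonoid.closure (S : Set M)
  have hu : ∑ s ∈ S, s ∈ C := sum_mem fun s hs => AddSubmonoid.subset_closure hs
  -- Carrying `-x` along lets the induction pass through negative scalars.
  suffices h : ∃ N : ℕ, x + N • ∑ s ∈ S, s ∈ C ∧ -x + N • ∑ s ∈ S, s ∈ C by
    obtain ⟨N, h, -⟩ := h
    exact ⟨N, h⟩
  induction hx using Submodule.span_induction with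
  | mem x hx =>
    refine ⟨1, add_mem (AddSubmonoid.subset_closure hx) (nsmul_mem hu 1), ?_⟩
    rw [one_smul, ← Finset.add_sum_erase S (fun s => s) hx, neg_add_cancel_left]
    exact sum_mem fun s hs => AddSubmonoid.subset_closure (Finset.mem_of_mem_erase hs)
  | zero => exact ⟨0, by simp, by simp⟩
  | add x y _ _ hx hy =>
    obtain ⟨N, hx, hx'⟩ := hx
    obtain ⟨K, hy, hy'⟩ := hy
    refine ⟨N + K, ?_, ?_⟩
    · convert add_mem hx hy using 1
      rw [add_smul]; abel
    · convert add_mem hx' hy' using 1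
      rw [add_smul]; abel
  | smul z x _ hx =>
    obtain ⟨N, hx, hx'⟩ := hx
    obtain ⟨m, rfl | rfl⟩ := z.eq_nat_or_neg
    · refine ⟨m * N, ?_, ?_⟩
      · convert nsmul_mem hx m using 1
        rw [smul_add, mul_smul, natCast_zsmul]
      · convert nsmul_mem hx' m using 1
        rw [smul_add, mul_smul, natCast_zsmul, smul_neg]
    · refine ⟨m * N, ?_, ?_⟩
      · convert nsmul_mem hx' m using 1
        rw [smul_add, mul_smul, neg_smul, natCast_zsmul, smul_neg]
      · convert nsmul_mem hx m using 1
        rw [smul_add, mul_smul, neg_smul, natCast_zsmul, neg_neg]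

/-- With `u = ∑ s ∈ T, s`, the vector `k(x + Nu)` exceeds `kx + Nu` by `(k-1)Nu`, which lies in the
monoid. -/
theorem IsSaturated.add_nsmul_sum_mem {S T : Finset M} (hS : IsSaturated (S : Set M))
    (hT : T ⊆ S) {k : ℕ} (hk : 0 < k) {x : M} {N : ℕ}
    (h : k • x + N • ∑ s ∈ T, s ∈ AddSubmonoid.closure (S : Set M)) :
    x + N • ∑ s ∈ T, s ∈ AddSubmonoid.closure (S : Set M) := by
  refine hS k _ hk ?_
  obtain ⟨m, rfl⟩ : ∃ m, k = m + 1 := ⟨k - 1, by omega⟩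
  have hu : ∑ s ∈ T, s ∈ AddSubmonoid.closure (S : Set M) :=
    sum_mem fun s hs => AddSubmonoid.subset_closure (hT hs)
  convert add_mem h (nsmul_mem hu (m * N)) using 1
  rw [smul_add, ← mul_smul, add_assoc, ← add_smul]
  congr 2
  ring

theorem mem_span_of_mem_closure {S : Set M} {x : M} (hx : x ∈ AddSubmonoid.closure S) :
    x ∈ Submodule.span ℤ S :=
  Submodule.closure_subset_span hx

theorem IsSaturated.mem_span_of_nsmul_mem {S : Finset M} (hS : IsSaturated (S : Set M))
    {k : ℕ} (hk : 0 < k) {x : M} (h : k • x ∈ Submodule.span ℤ (S : Set M)) :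
    x ∈ Submodule.span ℤ (S : Set M) := by
  obtain ⟨N, hN⟩ := exists_add_nsmul_sum_mem_closure S h
  have h1 := mem_span_of_mem_closure (hS.add_nsmul_sum_mem subset_rfl hk hN)
  have hu : N • ∑ s ∈ S, s ∈ Submodule.span ℤ (S : Set M) :=
    nsmul_mem (sum_mem fun s hs => Submodule.subset_span hs) N
  exact (Submodule.add_mem_iff_left _ hu).1 h1

theorem map_nonneg_of_mem_closure {S : Set M} {l : M →ₗ[ℤ] ℤ} (hl : ∀ s ∈ S, 0 ≤ l s) {x : M}
    (hx : x ∈ AddSubmonoid.closure S) : 0 ≤ l x := by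
  induction hx using AddSubmonoid.closure_induction with
  | mem x hx => exact hl x hx
  | zero => simp
  | add x y _ _ hx hy => rw [map_add]; exact add_nonneg hx hy

/-- A sum of nonnegative values vanishes only if every term does, so no generator off the face can
occur. -/
theorem mem_closure_face {S : Set M} {l : M →ₗ[ℤ] ℤ} (hl : ∀ s ∈ S, 0 ≤ l s) {x : M}
    (hx : x ∈ AddSubmonoid.closure S) (h0 : l x = 0) :
    x ∈ AddSubmonoid.closure {s ∈ S | l s = 0} := by
  induction hx using AddSubmonoid.closure_induction with
  | mem x hx => exact AddSubmonoid.subset_closure ⟨hx, h0⟩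
  | zero => exact zero_mem _
  | add x y hx' hy' hx hy =>
    rw [map_add] at h0
    have h1 := map_nonneg_of_mem_closure hl hx'
    have h2 := map_nonneg_of_mem_closure hl hy'
    exact add_mem (hx (by omega)) (hy (by omega))

theorem IsSaturated.face {S : Set M} (hS : IsSaturated S) {l : M →ₗ[ℤ] ℤ}
    (hl : ∀ s ∈ S, 0 ≤ l s) : IsSaturated {s ∈ S | l s = 0} := by
  intro k x hk hx
  have h1 : k • x ∈ AddSubmonoid.closure S :=
    AddSubmonoid.closure_mono (fun s hs => hs.1) hx
  have h2 : l (k • x) = 0 := by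
    refine Submodule.span_le (p := LinearMap.ker l).2 ?_ (mem_span_of_mem_closure hx)
    exact fun s hs => hs.2
  rw [map_nsmul, smul_eq_zero] at h2
  exact mem_closure_face hl (hS k x hk h1) (h2.resolve_left hk.ne')

theorem exists_pos_le_of_mem_closure {S : Set M} {l : M →ₗ[ℤ] ℤ} (hl : ∀ s ∈ S, 0 ≤ l s) {x : M}
    (hx : x ∈ AddSubmonoid.closure S) (h0 : 0 < l x) : ∃ s ∈ S, 0 < l s ∧ l s ≤ l x := by
  induction hx using AddSubmonoid.closure_induction with
  | mem x hx => exact ⟨x, hx, h0, le_rfl⟩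
  | zero => simp at h0
  | add x y hx' hy' hx hy =>
    rw [map_add] at h0 ⊢
    have h1 := map_nonneg_of_mem_closure hl hx'
    have h2 := map_nonneg_of_mem_closure hl hy'
    by_cases h : 0 < l x
    · obtain ⟨s, hs, hs0, hsx⟩ := hx h
      exact ⟨s, hs, hs0, by omega⟩
    · obtain ⟨s, hs, hs0, hsx⟩ := hy (by omega)
      exact ⟨s, hs, hs0, by omega⟩

/-- The quotient of `M` by `ℤS` is torsion-free by saturation, hence free, and functionals separate
the points of a free module. -/
theorem IsSaturated.exists_dual_ne_zero [Module.Finite ℤ M] {S : Finset M}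
    (hS : IsSaturated (S : Set M)) {x : M} (hx : x ∉ Submodule.span ℤ (S : Set M)) :
    ∃ l : M →ₗ[ℤ] ℤ, (∀ s ∈ S, l s = 0) ∧ l x ≠ 0 := by
  set L := Submodule.span ℤ (S : Set M) with hL
  have : Module.IsTorsionFree ℤ (M ⧸ L) := by
    refine .mk fun r hr => ?_
    rw [isRegular_iff_ne_zero] at hr
    refine (injective_iff_map_eq_zero (DistribSMul.toAddMonoidHom (M ⧸ L) r)).2 fun y hy => ?_
    obtain ⟨y, rfl⟩ := Submodule.Quotient.mk_surjective L y
    replace hy : r • (Submodule.Quotient.mk y : M ⧸ L) = 0 := hy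
    rw [← Submodule.Quotient.mk_smul, Submodule.Quotient.mk_eq_zero] at hy
    rw [Submodule.Quotient.mk_eq_zero]
    refine hS.mem_span_of_nsmul_mem (Int.natAbs_pos.2 hr) ?_
    rw [← natCast_zsmul]
    obtain h | h := Int.natAbs_eq r
    · rwa [← h]
    · rw [show ((r.natAbs : ℕ) : ℤ) = -r by omega, neg_smul]
      exact neg_mem hy
  have : Module.Free ℤ (M ⧸ L) := Module.free_of_finite_type_torsion_free'
  have h : (Submodule.Quotient.mk x : M ⧸ L) ≠ 0 := by
    rwa [Ne, Submodule.Quotient.mk_eq_zero]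
  rw [Ne, ← Module.forall_dual_apply_eq_zero_iff ℤ, not_forall] at h
  obtain ⟨f, hf⟩ := h
  refine ⟨f.comp L.mkQ, fun s hs => ?_, hf⟩
  have : L.mkQ s = 0 := by
    rw [Submodule.mkQ_apply, Submodule.Quotient.mk_eq_zero]
    exact Submodule.subset_span hs
  rw [LinearMap.comp_apply, this, map_zero]

theorem exists_ne_zero_of_mem_span {S : Set M} {l : M →ₗ[ℤ] ℤ} {x : M}
    (hx : x ∈ Submodule.span ℤ S) (h : l x ≠ 0) : ∃ s ∈ S, l s ≠ 0 := by
  by_contra! h'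
  exact h (Submodule.span_le (p := LinearMap.ker l).2 (fun s hs => h' s hs) hx)

/-- A finitely generated cone with saturated monoid that has a nontrivial supporting functional
has a facet: the lattice points of `ℤS` on the supporting hyperplane are spanned by the
generators on it. -/
theorem IsSaturated.exists_facet [Module.Finite ℤ M] {S : Finset M}
    (hS : IsSaturated (S : Set M))
    (hex : ∃ l : M →ₗ[ℤ] ℤ, (∀ s ∈ S, 0 ≤ l s) ∧ ∃ s ∈ S, l s ≠ 0) :
    ∃ l : M →ₗ[ℤ] ℤ, (∀ s ∈ S, 0 ≤ l s) ∧ (∃ s ∈ S, l s ≠ 0) ∧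
      ∀ x ∈ Submodule.span ℤ (S : Set M), l x = 0 →
        x ∈ Submodule.span ℤ {s ∈ (S : Set M) | l s = 0} := by
  classical
  let zeros (l : M →ₗ[ℤ] ℤ) : Finset M := S.filter fun s => l s = 0
  -- `l` vanishes on as many generators as possible. If its zeros failed to span, it could be tilted
  -- to vanish on one more.
  obtain ⟨l, ⟨hl, hl'⟩, hmin⟩ := WellFounded.has_min
    (measure fun l : M →ₗ[ℤ] ℤ => S.card - (zeros l).card).wf
    {l | (∀ s ∈ S, 0 ≤ l s) ∧ ∃ s ∈ S, l s ≠ 0} hex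
  refine ⟨l, hl, hl', fun x hx hx0 => ?_⟩
  by_contra hxs
  have hcoe : {s ∈ (S : Set M) | l s = 0} = (zeros l : Set M) := by simp [zeros]
  have hsat : IsSaturated ((zeros l : Finset M) : Set M) := hcoe ▸ hS.face hl
  rw [hcoe] at hxs
  obtain ⟨f, hf, hfx, s₀, hs₀, hfs₀⟩ : ∃ f : M →ₗ[ℤ] ℤ, (∀ s ∈ zeros l, f s = 0) ∧ f x ≠ 0 ∧
      ∃ s ∈ S, f s < 0 := by
    obtain ⟨f, hf, hfx⟩ := hsat.exists_dual_ne_zero hxs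
    obtain ⟨s, hs, hfs⟩ := exists_ne_zero_of_mem_span hx hfx
    rcases lt_or_gt_of_ne hfs with h | h
    · exact ⟨f, hf, hfx, s, hs, h⟩
    · exact ⟨-f, fun s hs => by simp [hf s hs], by simpa using hfx, s, hs, by simpa using h⟩
  -- As `ε` grows from 0, `t` is a first generator with `f < 0` at which `l + εf` reaches zero; `g`
  -- below is this `l + εf` with denominators cleared.
  obtain ⟨t, ht, htmin⟩ := (S.filter fun s => f s < 0).exists_min_image
    (fun s => (l s : ℚ) / (-f s : ℚ)) ⟨s₀, by simp [hs₀, hfs₀]⟩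
  rw [Finset.mem_filter] at ht
  have hlt : l t ≠ 0 := fun h => ht.2.ne (hf t (by simp [zeros, ht.1, h]))
  have hlt' : 0 < l t := lt_of_le_of_ne (hl t ht.1) hlt.symm
  let g : M →ₗ[ℤ] ℤ := (-f t) • l + l t • f
  have hg (y : M) : g y = -f t * l y + l t * f y := by simp [g]
  have hgpos : ∀ s ∈ S, 0 ≤ g s := by
    intro s hs
    rw [hg]
    rcases lt_or_ge (f s) 0 with h | h
    · have h1 := htmin s (by simp [hs, h])
      have h2 : (0 : ℚ) < -f t := by exact_mod_cast neg_pos.2 ht.2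
      have h3 : (0 : ℚ) < -f s := by exact_mod_cast neg_pos.2 h
      rw [div_le_div_iff₀ h2 h3] at h1
      have h4 : l t * -f s ≤ l s * -f t := by exact_mod_cast h1
      linarith
    · have h1 := mul_nonneg (neg_pos.2 ht.2).le (hl s hs)
      have h2 := mul_nonneg hlt'.le h
      linarith
  have hgne : ∃ s ∈ S, g s ≠ 0 :=
    exists_ne_zero_of_mem_span hx (by rw [hg, hx0]; simp [hlt, hfx])
  refine hmin g ⟨hgpos, hgne⟩ ?_
  have hss : zeros l ⊂ zeros g := by
    refine Finset.ssubset_iff_of_subset (fun s hs => ?_) |>.2 ⟨t, ?_, ?_⟩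
    · have h1 := hf s hs
      simp only [zeros, Finset.mem_filter] at hs ⊢
      exact ⟨hs.1, by rw [hg, hs.2, h1]; ring⟩
    · simp only [zeros, Finset.mem_filter]
      exact ⟨ht.1, by rw [hg]; ring⟩
    · simp [zeros, hlt]
  have h1 := Finset.card_lt_card hss
  have h2 : (zeros g).card ≤ S.card := Finset.card_filter_le _ _
  change S.card - (zeros g).card < S.card - (zeros l).card
  omega

/-- Modulo the facet lattice, `l(t)x` equals `l(x)t`, which is in the monoid. Adding a large
multiple of the sum of the facet generators therefore moves `l(t)x`, and by saturation `x` itself,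
into the monoid without changing the value of `l`; some generator in the resulting expression has a
suitable height. -/
theorem IsSaturated.exists_pos_le [Module.Finite ℤ M] {S : Finset M}
    (hS : IsSaturated (S : Set M)) {l : M →ₗ[ℤ] ℤ} (hl : ∀ s ∈ S, 0 ≤ l s)
    (hfacet : ∀ x ∈ Submodule.span ℤ (S : Set M), l x = 0 →
      x ∈ Submodule.span ℤ {s ∈ (S : Set M) | l s = 0})
    {x : M} (hx : x ∈ Submodule.span ℤ (S : Set M)) (h0 : 0 < l x) :
    ∃ s ∈ S, 0 < l s ∧ l s ≤ l x := by
  classical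
  obtain ⟨t, ht, hlt⟩ := exists_ne_zero_of_mem_span hx h0.ne'
  have hlt' : 0 < l t := lt_of_le_of_ne (hl t ht) hlt.symm
  set T : Finset M := S.filter fun s => l s = 0 with hT
  have hcoe : {s ∈ (S : Set M) | l s = 0} = (T : Set M) := by simp [hT]
  have hTS : T ⊆ S := Finset.filter_subset _ _
  have h1 : (l t).toNat • x - (l x).toNat • t ∈ Submodule.span ℤ (T : Set M) := by
    rw [← hcoe]
    refine hfacet _ (sub_mem (nsmul_mem hx _) (nsmul_mem (Submodule.subset_span ht) _)) ?_
    rw [map_sub, map_nsmul, map_nsmul, nsmul_eq_mul, nsmul_eq_mul, Int.toNat_of_nonneg hlt'.le,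
      Int.toNat_of_nonneg h0.le]
    ring
  obtain ⟨N, hN⟩ := exists_add_nsmul_sum_mem_closure T h1
  have h2 : (l t).toNat • x + N • ∑ s ∈ T, s ∈ AddSubmonoid.closure (S : Set M) := by
    convert add_mem (AddSubmonoid.closure_mono (Finset.coe_subset.2 hTS) hN)
      (nsmul_mem (AddSubmonoid.subset_closure (Finset.mem_coe.2 ht)) (l x).toNat) using 1
    abel
  have h3 := hS.add_nsmul_sum_mem hTS (by omega) h2
  have h4 : l (x + N • ∑ s ∈ T, s) = l x := by
    rw [map_add, map_nsmul, map_sum, Finset.sum_eq_zero fun s hs => (Finset.mem_filter.1 hs).2,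
      smul_zero, add_zero]
  simpa only [h4, Finset.mem_coe] using exists_pos_le_of_mem_closure hl h3 (h4.symm ▸ h0)

/-- A Hilbert base of a pointed cone contains a basis of the lattice that it generates. -/
theorem IsSaturated.exists_basis [Module.Finite ℤ M] [Module.IsTorsionFree ℤ M]
    (δ : M →ₗ[ℤ] ℤ) (S : Finset M) (hδ : ∀ s ∈ S, 0 < δ s) (hS : IsSaturated (S : Set M)) :
    ∃ B ⊆ S, LinearIndepOn ℤ id (B : Set M) ∧
      Submodule.span ℤ (B : Set M) = Submodule.span ℤ (S : Set M) := by
  classical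
  induction S using Finset.strongInduction with
  | H S ih =>
  rcases S.eq_empty_or_nonempty with rfl | ⟨s₀, hs₀⟩
  · exact ⟨∅, subset_rfl, by simp, rfl⟩
  -- `δ` stays positive on the generators of every face, so each nonempty stage of the induction has
  -- a facet.
  obtain ⟨l, hl, ⟨s₁, hs₁, hls₁⟩, hfacet⟩ := hS.exists_facet
    ⟨δ, fun s hs => (hδ s hs).le, s₀, hs₀, (hδ s₀ hs₀).ne'⟩
  set T : Finset M := S.filter fun s => l s = 0 with hT
  have hcoe : {s ∈ (S : Set M) | l s = 0} = (T : Set M) := by simp [hT]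
  have hTS : T ⊆ S := Finset.filter_subset _ _
  have hTss : T ⊂ S := Finset.ssubset_iff_of_subset hTS |>.2 ⟨s₁, hs₁, by simp [hT, hls₁]⟩
  obtain ⟨B, hBT, hBli, hBspan⟩ := ih T hTss (fun s hs => hδ s (hTS hs)) (hcoe ▸ hS.face hl)
  obtain ⟨w, hw, hwmin⟩ := (S.filter fun s => 0 < l s).exists_min_image (fun s => l s)
    ⟨s₁, Finset.mem_filter.2 ⟨hs₁, lt_of_le_of_ne (hl s₁ hs₁) hls₁.symm⟩⟩
  rw [Finset.mem_filter] at hw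
  obtain ⟨hwS, hw0⟩ := hw
  have hBl : ∀ x ∈ Submodule.span ℤ (B : Set M), l x = 0 := fun x hx =>
    Submodule.span_le (p := LinearMap.ker l).2
      (fun s hs => (Finset.mem_filter.1 (hBT hs)).2) hx
  have hwne : w ≠ 0 := fun h => by simp [h] at hw0
  refine ⟨B ∪ {w}, Finset.union_subset (hBT.trans hTS) (by simpa using hwS), ?_, ?_⟩
  · rw [Finset.coe_union, Finset.coe_singleton]
    refine hBli.id_union (LinearIndepOn.singleton hwne) ?_
    rw [Submodule.disjoint_def]
    intro x hxB hxw
    obtain ⟨c, rfl⟩ := Submodule.mem_span_singleton.1 hxw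
    have h := hBl _ hxB
    rw [map_smul, smul_eq_mul, mul_eq_zero] at h
    rw [h.resolve_right hw0.ne', zero_smul]
  · refine le_antisymm (Submodule.span_mono ?_) (Submodule.span_le.2 fun s hs => ?_)
    · exact Finset.coe_subset.2 (Finset.union_subset (hBT.trans hTS) (by simpa using hwS))
    · have hsS : s ∈ Submodule.span ℤ (S : Set M) := Submodule.subset_span hs
      have hy : s - (l s / l w) • w ∈ Submodule.span ℤ (S : Set M) :=
        sub_mem hsS (Submodule.smul_mem _ _ (Submodule.subset_span hwS))
      have hly : l (s - (l s / l w) • w) = l s % l w := by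
        rw [map_sub, map_smul, smul_eq_mul, Int.emod_def, mul_comm]
      -- A nonzero remainder modulo `l w` would bound from above the height of a generator lower
      -- than `w`.
      have hly0 : l (s - (l s / l w) • w) = 0 := by
        by_contra hne
        have hpos : 0 < l (s - (l s / l w) • w) :=
          lt_of_le_of_ne (hly ▸ Int.emod_nonneg _ hw0.ne') (Ne.symm hne)
        obtain ⟨t, ht, ht0, hle⟩ := hS.exists_pos_le hl hfacet hy hpos
        have h1 := hwmin t (Finset.mem_filter.2 ⟨ht, ht0⟩)
        have h2 := Int.emod_lt_of_pos (l s) hw0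
        omega
      have h1 := hfacet _ hy hly0
      rw [hcoe, ← hBspan] at h1
      have h2 : s - (l s / l w) • w ∈ Submodule.span ℤ ((B ∪ {w} : Finset M) : Set M) :=
        Submodule.span_mono (by simp) h1
      have h3 : (l s / l w) • w ∈ Submodule.span ℤ ((B ∪ {w} : Finset M) : Set M) :=
        Submodule.smul_mem _ _ (Submodule.subset_span (by simp))
      simpa using add_mem h2 h3

end HilbertBasis

namespace MonomialCremona

open MvPolynomial

/-! ### The lattice generated by `(H,1)`. -/

section Lattice

variable {n : ℕ}

/-- The vector `(v,1)` as an element of `ℤⁿ × ℤ`. -/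
def liftOne (v : Fin n → ℕ) : (Fin n → ℤ) × ℤ := (fun i => (v i : ℤ), 1)

/-- The embedding `ℤⁿ × ℤ → ℝⁿ⁺¹`. -/
def realSnoc : (Fin n → ℤ) × ℤ →+ (Fin (n + 1) → ℝ) where
  toFun x := Fin.snoc (fun i => (x.1 i : ℝ)) (x.2 : ℝ)
  map_zero' := by
    ext i
    refine Fin.lastCases ?_ (fun i => ?_) i <;> simp
  map_add' x y := by
    ext i
    refine Fin.lastCases ?_ (fun i => ?_) i <;> simp

theorem realSnoc_injective : Function.Injective (realSnoc (n := n)) := by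
  intro x y h
  ext i
  · simpa [realSnoc] using congrFun h (Fin.castSucc i)
  · simpa [realSnoc] using congrFun h (Fin.last n)

theorem realSnoc_mem_integerPoints (x : (Fin n → ℤ) × ℤ) :
    realSnoc x ∈ integerPoints (n + 1) := by
  refine ⟨Fin.snoc x.1 x.2, ?_⟩
  ext i
  refine Fin.lastCases ?_ (fun i => ?_) i <;> simp [realSnoc]

theorem adjoinOne_eq_image (H : Set (Fin n → ℕ)) :
    adjoinOne H = realSnoc '' (liftOne '' H) := by
  rw [Set.image_image]
  simp [adjoinOne, realSnoc, liftOne]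

/-- A real cone is stable under division by `k`, so an integer point with a multiple in the cone is
itself in the cone. -/
theorem IsHilbertBase.isSaturated {H : Set (Fin n → ℕ)} (hH : IsHilbertBase (adjoinOne H)) :
    IsSaturated (liftOne '' H) := by
  intro k x hk hx
  have hcl : ∀ y, realSnoc y ∈ AddSubmonoid.closure (adjoinOne H) ↔
      y ∈ AddSubmonoid.closure (liftOne '' H) := by
    intro y
    rw [adjoinOne_eq_image, ← AddMonoidHom.map_mclosure]
    exact AddSubmonoid.mem_map_iff_mem realSnoc_injective
  rw [← hcl, ← SetLike.mem_coe, ← hH.2]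
  refine ⟨realSnoc_mem_integerPoints x, ?_⟩
  rw [← hcl, ← SetLike.mem_coe, ← hH.2, map_nsmul] at hx
  have h := PointedCone.smul_mem _ (inv_nonneg.2 (Nat.cast_nonneg (α := ℝ) k)) hx.2
  rwa [← Nat.cast_smul_eq_nsmul ℝ, smul_smul, inv_mul_cancel₀ (by exact_mod_cast hk.ne'),
    one_smul] at h

theorem sum_fst_of_mem_span {d : ℕ} {H : Set (Fin n → ℕ)} (hd : IsStochastic d H)
    {x : (Fin n → ℤ) × ℤ} (hx : x ∈ Submodule.span ℤ (liftOne '' H)) :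
    ∑ i, x.1 i = d * x.2 := by
  induction hx using Submodule.span_induction with
  | mem x hx =>
    obtain ⟨v, hv, rfl⟩ := hx
    simp [liftOne, ← hd.2 v hv]
  | zero => simp
  | add x y _ _ hx hy => simp [Finset.sum_add_distrib, hx, hy, mul_add]
  | smul z x _ hx =>
    simp [← Finset.mul_sum, hx]
    ring

theorem map_fst_span (H : Set (Fin n → ℕ)) :
    (Submodule.span ℤ (liftOne '' H)).map (LinearMap.fst ℤ (Fin n → ℤ) ℤ) = lattice H := by
  rw [LinearMap.map_span, Set.image_image]
  rfl

/-- On this lattice the coordinate sum is `d` times the last coordinate; as `d ≠ 0`, forgetting the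
latter is injective. -/
theorem finrank_span_liftOne {d : ℕ} {H : Set (Fin n → ℕ)} (hd : IsStochastic d H) :
    Module.finrank ℤ (Submodule.span ℤ (liftOne '' H)) = Module.finrank ℤ (lattice H) := by
  rw [← map_fst_span, ← LinearMap.range_domRestrict, LinearMap.finrank_range_of_inj]
  rw [injective_iff_map_eq_zero]
  rintro ⟨x, hx⟩ h
  replace h : x.1 = 0 := h
  have h1 := sum_fst_of_mem_span hd hx
  have hd0 : (d : ℤ) ≠ 0 := by exact_mod_cast (Nat.one_le_iff_ne_zero.1 hd.1)
  simp only [h, Pi.zero_apply, Finset.sum_const_zero] at h1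
  have h2 : x.2 = 0 := (mul_eq_zero.1 h1.symm).resolve_left hd0
  exact Subtype.ext (Prod.ext h h2)

theorem exists_smul_mem_lattice {H : Set (Fin n → ℕ)}
    (hrank : Module.finrank ℤ (lattice H) = n) (x : Fin n → ℤ) :
    ∃ k : ℕ, 0 < k ∧ k • x ∈ lattice H := by
  have : Finite ((Fin n → ℤ) ⧸ lattice H) :=
    Submodule.finiteQuotientOfFreeOfRankEq _ (by simpa using hrank)
  refine ⟨Nat.card ((Fin n → ℤ) ⧸ lattice H), Nat.card_pos, ?_⟩
  rw [← Submodule.Quotient.mk_eq_zero, Submodule.Quotient.mk_smul]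
  exact card_nsmul_eq_zero'

/-- Full rank puts a positive multiple `kx` in `ℤH`. Its lift to `ℤ(H,1)` has last coordinate 0
because `d ≠ 0`, and saturation divides by `k`. -/
theorem mem_span_liftOne_of_sum_eq_zero {d : ℕ} {H : Finset (Fin n → ℕ)}
    (hd : IsStochastic d (H : Set (Fin n → ℕ)))
    (hrank : Module.finrank ℤ (lattice (H : Set (Fin n → ℕ))) = n)
    (hH : IsHilbertBase (adjoinOne (H : Set (Fin n → ℕ)))) {x : Fin n → ℤ}
    (hx : ∑ i, x i = 0) :
    (x, (0 : ℤ)) ∈ Submodule.span ℤ (liftOne '' (H : Set (Fin n → ℕ))) := by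
  classical
  obtain ⟨k, hk, hkx⟩ := exists_smul_mem_lattice hrank x
  rw [← map_fst_span] at hkx
  obtain ⟨y, hy, hyx⟩ := hkx
  replace hyx : y.1 = k • x := hyx
  have h1 := sum_fst_of_mem_span hd hy
  have hd0 : (d : ℤ) ≠ 0 := by exact_mod_cast (Nat.one_le_iff_ne_zero.1 hd.1)
  have h2 : ∑ i, y.1 i = 0 := by simp [hyx, ← Finset.mul_sum, hx]
  rw [h2] at h1
  have h3 : y.2 = 0 := (mul_eq_zero.1 h1.symm).resolve_left hd0
  have h4 : k • (x, (0 : ℤ)) = y := Prod.ext (by simp [hyx]) (by simp [h3])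
  have hsat := hH.isSaturated
  rw [← Finset.coe_image] at hsat hy ⊢
  exact hsat.mem_span_of_nsmul_mem hk (h4 ▸ hy)

/-- The vectors `w₁, …, wₙ` are chosen in `H` so that the `(wⱼ,1)` form a basis of the lattice
generated by `(H,1)`. -/
theorem exists_lattice_basis {d : ℕ} {H : Finset (Fin n → ℕ)}
    (hd : IsStochastic d (H : Set (Fin n → ℕ)))
    (hrank : Module.finrank ℤ (lattice (H : Set (Fin n → ℕ))) = n)
    (hH : IsHilbertBase (adjoinOne (H : Set (Fin n → ℕ)))) :
    ∃ w : Fin n → Fin n → ℕ, (∀ j, w j ∈ H) ∧ LinearIndependent ℤ (fun j => liftOne (w j)) ∧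
      ∀ x : Fin n → ℤ, ∑ i, x i = 0 → ∃ c : Fin n → ℤ, ∑ l, c l • liftOne (w l) = (x, 0) := by
  classical
  have hsat := hH.isSaturated
  have hmem := fun x hx => mem_span_liftOne_of_sum_eq_zero (x := x) hd hrank hH hx
  have hfin := finrank_span_liftOne hd
  rw [← Finset.coe_image] at hsat hfin
  simp only [← Finset.coe_image] at hmem
  obtain ⟨B, hBS, hBli, hBspan⟩ := hsat.exists_basis (LinearMap.snd ℤ (Fin n → ℤ) ℤ)
    (H.image liftOne) (by simp [liftOne])
  have hcard : B.card = n := by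
    rw [← finrank_span_finset_eq_card hBli, hBspan, hfin, hrank]
  let e : Fin n ≃ B := (B.equivFinOfCardEq hcard).symm
  have hpre (j : Fin n) : ∃ v ∈ H, liftOne v = (e j : (Fin n → ℤ) × ℤ) :=
    Finset.mem_image.1 (hBS (e j).2)
  choose w hwH hwe using hpre
  refine ⟨w, hwH, ?_, fun x hx => ?_⟩
  · simp only [hwe]
    exact LinearIndependent.comp hBli e e.injective
  · have h := hmem x hx
    have hr : Set.range (fun j => liftOne (w j)) = (B : Set ((Fin n → ℤ) × ℤ)) := by
      simp only [hwe]
      ext y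
      simp only [Set.mem_range, Finset.mem_coe]
      exact ⟨fun ⟨j, hj⟩ => hj ▸ (e j).2, fun hy => ⟨e.symm ⟨y, hy⟩, by simp⟩⟩
    rw [← hBspan, ← hr] at h
    exact (Submodule.mem_span_range_iff_exists_fun ℤ).1 h

end Lattice

/-! ### Monomial maps and the inverse. -/

section Monomials

variable {k : Type*} [Field k] {n : ℕ}

theorem logMonomial_add (a b : Fin n → ℕ) :
    logMonomial k (a + b) = logMonomial k a * logMonomial k b := by
  simp [logMonomial, pow_add, Finset.prod_mul_distrib]

theorem logMonomial_single (i : Fin n) : logMonomial k (Pi.single i 1) = X i := by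
  classical
  rw [logMonomial, Finset.prod_eq_single i] <;> simp +contextual

theorem logMonomial_ne_zero (a : Fin n → ℕ) : logMonomial k a ≠ 0 :=
  Finset.prod_ne_zero_iff.2 fun i _ => pow_ne_zero _ (X_ne_zero i)

theorem isHomogeneous_logMonomial (a : Fin n → ℕ) :
    (logMonomial k a).IsHomogeneous (∑ i, a i) := by
  refine IsHomogeneous.prod _ _ _ fun i _ => ?_
  simpa using (isHomogeneous_X k i).pow (a i)

theorem isRationalMap_logMonomial [NeZero n] {e : ℕ} {f : Fin n → Fin n → ℕ}
    (hf : ∀ i, ∑ j, f i j = e) : IsRationalMap fun i => logMonomial k (f i) :=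
  ⟨⟨e, fun i => hf i ▸ isHomogeneous_logMonomial (f i)⟩,
    fun h => logMonomial_ne_zero (f 0) (congrFun h 0)⟩

theorem compForms_logMonomial (g f : Fin n → Fin n → ℕ) (i : Fin n) :
    compForms (fun i => logMonomial k (g i)) (fun i => logMonomial k (f i)) i =
      logMonomial k (∑ l, g i l • f l) := by
  simp only [compForms, logMonomial, map_prod, map_pow, bind₁_X_right, Finset.sum_apply,
    Pi.smul_apply, smul_eq_mul, ← Finset.prod_pow_eq_pow_sum, ← Finset.prod_pow, ← pow_mul']
  rw [Finset.prod_comm]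

/-- The hypothesis says that the exponents of the composite are `eᵢ` plus a vector independent of
`i`, written without subtraction. -/
theorem compIsIdentity_logMonomial [NeZero n] {g f : Fin n → Fin n → ℕ}
    (h : ∀ i j, ∑ l, g i l • f l + Pi.single j 1 = ∑ l, g j l • f l + Pi.single i 1) :
    CompIsIdentity (fun i => logMonomial k (g i)) (fun i => logMonomial k (f i)) := by
  refine ⟨fun h0 => ?_, fun i j => ?_⟩
  · have h1 := congrFun h0 0
    rw [compForms_logMonomial] at h1
    exact logMonomial_ne_zero _ h1
  · simp only [compForms_logMonomial, ← logMonomial_single, ← logMonomial_add, h i j]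

theorem definesCremona_logMonomial [NeZero n] {d : ℕ} {w : Fin n → Fin n → ℕ}
    (hd : ∀ j, ∑ i, w j i = d) (hli : LinearIndependent ℤ fun j => liftOne (w j))
    (hspan : ∀ x : Fin n → ℤ, ∑ i, x i = 0 →
      ∃ c : Fin n → ℤ, ∑ l, c l • liftOne (w l) = (x, 0)) :
    DefinesCremona fun j => logMonomial k (w j) := by
  classical
  have hsum (i : Fin n) : ∑ p, (Pi.single i 1 - Pi.single 0 1 : Fin n → ℤ) p = 0 := by
    simp [Pi.single_apply]
  choose c hc using fun i => hspan _ (hsum i)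
  have hc1 (i p : Fin n) : ∑ l, c i l * (w l p : ℤ) =
      (Pi.single i 1 : Fin n → ℤ) p - (Pi.single 0 1 : Fin n → ℤ) p := by
    simpa [liftOne, Prod.fst_sum] using congrFun (congrArg Prod.fst (hc i)) p
  have hc2 (i : Fin n) : ∑ l, c i l = 0 := by
    simpa [liftOne, Prod.snd_sum] using congrArg Prod.snd (hc i)
  -- The shift `m` makes all exponents nonnegative. Being independent of `i`, it changes the
  -- composite with `w` only by a common monomial factor and, as the rows of `c` sum to 0, keeps the
  -- degrees of the forms equal.
  let m (l : Fin n) : ℕ := ∑ i, (c i l).natAbs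
  let g (i l : Fin n) : ℕ := (c i l + m l).toNat
  have hg (i l : Fin n) : (g i l : ℤ) = c i l + m l := by
    refine Int.toNat_of_nonneg ?_
    have h : (c i l).natAbs ≤ m l :=
      Finset.single_le_sum (f := fun i => (c i l).natAbs) (fun _ _ => Nat.zero_le _)
        (Finset.mem_univ i)
    omega
  have hgsum (i : Fin n) : ∑ l, g i l = ∑ l, m l := by
    zify
    simp only [hg, Finset.sum_add_distrib, hc2, zero_add]
  have hdz (j : Fin n) : ∑ i, (w j i : ℤ) = d := by exact_mod_cast hd j
  have hsingle (i p : Fin n) : (((Pi.single i 1 : Fin n → ℕ) p : ℕ) : ℤ) =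
      (Pi.single i 1 : Fin n → ℤ) p := by
    simp [Pi.single_apply]
  refine ⟨isRationalMap_logMonomial hd, fun i => logMonomial k (g i),
    isRationalMap_logMonomial hgsum, compIsIdentity_logMonomial fun i j => ?_,
    compIsIdentity_logMonomial fun i j => ?_⟩
  · ext p
    zify
    simp only [Pi.add_apply, Finset.sum_apply, Pi.smul_apply, smul_eq_mul, Nat.cast_add,
      Nat.cast_sum, Nat.cast_mul, hg, add_mul, Finset.sum_add_distrib, hc1, hsingle]
    ring
  -- `a` is the defect of the required exponent identity. Pairing it with the vectors `(wₚ,1)`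
  -- leaves a multiple of `e₀` whose coefficient is a difference of two coordinate sums, both equal
  -- to `d`; independence then gives `a = 0`.
  · let a (p : Fin n) : ℤ := ∑ l, ((w i l : ℤ) - w j l) * c l p +
      ((Pi.single j 1 : Fin n → ℤ) p - (Pi.single i 1 : Fin n → ℤ) p)
    have ha : ∀ p, a p = 0 := by
      refine Fintype.linearIndependent_iff.1 hli a ?_
      have h1 : ∑ p, a p • liftOne (w p) =
          ∑ l, ((w i l : ℤ) - w j l) • ∑ p, c l p • liftOne (w p) +
            (liftOne (w j) - liftOne (w i)) := by
        simp only [a, add_smul, Finset.sum_add_distrib, Finset.sum_smul, mul_smul,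
          Finset.smul_sum]
        rw [Finset.sum_comm]
        congr 1
        simp [Pi.single_apply, sub_smul, Finset.sum_sub_distrib]
      rw [h1]
      simp only [hc]
      ext p
      · simp [liftOne, Prod.fst_sum, Pi.single_apply, mul_sub, Finset.sum_sub_distrib,
          ← Finset.sum_mul, hdz]
      · simp [liftOne, Prod.snd_sum]
    ext p
    zify
    have h2 := ha p
    simp only [a, sub_mul, Finset.sum_sub_distrib] at h2
    simp only [Pi.add_apply, Finset.sum_apply, Pi.smul_apply, smul_eq_mul, Nat.cast_add,
      Nat.cast_sum, Nat.cast_mul, hg, mul_add, Finset.sum_add_distrib, hsingle,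
      ← Finset.sum_mul, hdz]
    linarith

end Monomials

end MonomialCremona

theorem mainTheorem9 (k : Type*) [Field k] (n : ℕ) (hn : 2 ≤ n) (d : ℕ)
    (H : Finset (Fin n → ℕ))
    (hd : MonomialCremona.IsStochastic d (H : Set (Fin n → ℕ)))
    (hrank : Module.finrank ℤ (MonomialCremona.lattice (H : Set (Fin n → ℕ))) = n)
    (hH : MonomialCremona.IsHilbertBase
      (MonomialCremona.adjoinOne (H : Set (Fin n → ℕ)))) :
    ∃ w : Fin n → (Fin n → ℕ), Function.Injective w ∧ (∀ j, w j ∈ H) ∧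
      MonomialCremona.DefinesCremona (fun j => MonomialCremona.logMonomial k (w j)) := by
  have : NeZero n := ⟨by omega⟩
  obtain ⟨w, hwH, hli, hspan⟩ := MonomialCremona.exists_lattice_basis hd hrank hH
  refine ⟨w, fun i j hij => hli.injective (by simp [hij]), hwH, ?_⟩
  exact MonomialCremona.definesCremona_logMonomial (fun j => hd.2 _ (hwH j)) hli hspan
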